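/- For a real symmetric $n\times n$ matrix $A$ ($n\ge 1$) with operator norm $\|A\|$, let $$\alpha=\max\{\operatorname{tr}(AX): X\succeq 0,\ X_{ii}=1 \text{ for all } i\}$$ be the value of the MaxQP SDP. The renormalized MaxQP SDP is to maximize $\operatorname{tr}(\|A\|^{-1}AX)$ (read as $0$ if $A=0$) over real positive semidefinite matrices $X$ with $\operatorname{tr}X=1$ and $X_{ii}=1/n$ for all $i$; let $\beta$ be its optimal value. For $\delta\ge 0$, call $X\succeq0$ with $\operatorname{tr}X=1$ *$\delta$-approximately feasible* if $\sum_{i}|X_{ii}-\tfrac1n|\le\delta$, let $\alpha_\delta$ be the supremum of $\operatorname{tr}(\|A\|^{-1}AX)$ over all such $X$, and call $\rho$ a *$\delta$-approximate solution* if it is $\delta$-approximately feasible and $\operatorname{tr}(\|A\|^{-1}A\rho)\ge\beta-\delta$. Given $\rho$ and $\epsilon>0$, let $B=\{i: |\rho_{ii}-\tfrac1n|>\epsilon^2/n\}$; let $\rho'$ be obtained from $\rho$ by setting to zero all rows and columns with index in $B$ and then putting $1/n$ on the diagonal at the indices in $B$; let $R$ be obtained from $\rho'$ by replacing every diagonal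 entry by $1/n$; and put $$\rho^\sharp=\frac{1}{1+\epsilon^2}\Big(R+\frac{\epsilon^2}{n}I\Big).$$ **Proposition.** There are absolute constants $C$ and $K$ and a single real-RAM program (unit cost for arithmetic, comparisons and indirectly addressed memory accesses, where index registers hold natural numbers and are only added and subtracted) such that for all $n\ge1$, all real symmetric $n\times n$ matrices $A$ and all $\epsilon>0$: 1. $\big|\alpha_{\epsilon^4}\, n\|A\|-\alpha\big|\le C\,\epsilon\, n\|A\|$. 2. Let $\rho$ be any $\epsilon^4$-approximate solution. Then $\big|\operatorname{tr}(\|A\|^{-1}A\rho)\, n\|A\|-\alpha\big|\le C\,\epsilon\, n\|A\|$. Moreover $X=n\rho^\sharp$ is exactly feasible for the MaxQP SDP, i.e. $X\succeq0$ and $X_{ii}=1$ for all $i$; it satisfies $\big|\operatorname{tr}(AX)-\alpha\big|\le C\,\epsilon\, n\|A\|$; and the program, started on $(n,\epsilon,\rho)$, outputs $X$ after at most $K n^2$ steps. -/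

import Mathlib

/-! ### The semidefinite programs -/

noncomputable section

namespace MaxQP

open Matrix

/-- The operator (Schatten-`∞`, i.e. spectral) norm of a real square matrix. -/
def opNorm {n : ℕ} (A : Matrix (Fin n) (Fin n) ℝ) : ℝ :=
  ‖Matrix.toEuclideanCLM (n := Fin n) (𝕜 := ℝ) A‖

/-- Feasible set of the MaxQP SDP: positive semidefinite matrices with unit diagonal. -/
def Feasible (n : ℕ) : Set (Matrix (Fin n) (Fin n) ℝ) :=
  {X | X.PosSemidef ∧ ∀ i, X i i = 1}

/-- Optimal value of the MaxQP SDP: maximize `tr (A X)` over the feasible set. -/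
def value {n : ℕ} (A : Matrix (Fin n) (Fin n) ℝ) : ℝ :=
  sSup ((fun X => (A * X).trace) '' Feasible n)

/-- Quantum states: positive semidefinite matrices of trace one. -/
def State (n : ℕ) : Set (Matrix (Fin n) (Fin n) ℝ) :=
  {X | X.PosSemidef ∧ X.trace = 1}

/-- Objective function of the renormalized MaxQP SDP. -/
def renormObjective {n : ℕ} (A X : Matrix (Fin n) (Fin n) ℝ) : ℝ :=
  (((1 / opNorm A) • A) * X).trace

/-- Feasible set of the renormalized MaxQP SDP. -/
def RenormFeasible (n : ℕ) : Set (Matrix (Fin n) (Fin n) ℝ) :=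
  {X | X ∈ State n ∧ ∀ i, X i i = 1 / (n : ℝ)}

/-- Optimal value of the renormalized MaxQP SDP. -/
def renormValue {n : ℕ} (A : Matrix (Fin n) (Fin n) ℝ) : ℝ :=
  sSup (renormObjective A '' RenormFeasible n)

/-- States that are feasible for the renormalized MaxQP SDP up to accuracy `δ`. -/
def ApproxFeasible (n : ℕ) (δ : ℝ) : Set (Matrix (Fin n) (Fin n) ℝ) :=
  {X | X ∈ State n ∧ ∑ i, |X i i - 1 / (n : ℝ)| ≤ δ}

/-- Optimal value of the relaxation in which feasibility is only required up to accuracy `δ`. -/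
def relaxedValue {n : ℕ} (δ : ℝ) (A : Matrix (Fin n) (Fin n) ℝ) : ℝ :=
  sSup (renormObjective A '' ApproxFeasible n δ)

/-- `ρ` is an approximately optimal, approximately feasible solution, up to accuracy `δ`, of the
renormalized MaxQP SDP.  Optimality is measured against the exactly feasible points, which is
implied by optimality (up to `δ`) among all approximately feasible points. -/
def IsApproxSolution {n : ℕ} (δ : ℝ) (A ρ : Matrix (Fin n) (Fin n) ℝ) : Prop :=
  ρ ∈ ApproxFeasible n δ ∧ renormValue A - δ ≤ renormObjective A ρ

/-! The suprema above are taken over nonempty sets that are bounded above. -/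

theorem abs_entry_le {n : ℕ} {X : Matrix (Fin n) (Fin n) ℝ} (hX : X.PosSemidef) (i j : Fin n) :
    |X i j| ≤ (X i i + X j j) / 2 := by
  have hs : X j i = X i j := by simpa using hX.isHermitian.apply i j
  have key : ∀ c : ℝ, 0 ≤ X i i + c * X i j + c * X j i + c ^ 2 * X j j := by
    intro c
    have h := hX.dotProduct_mulVec_nonneg (Pi.single i 1 + c • Pi.single j 1)
    simp only [star_trivial, Matrix.mulVec_add, Matrix.mulVec_smul, add_dotProduct,
      dotProduct_add, smul_dotProduct, dotProduct_smul, Matrix.mulVec_single_one,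
      single_one_dotProduct, Matrix.col_apply, smul_eq_mul] at h
    linarith
  have h1 := key 1
  have h2 := key (-1)
  rw [hs] at h1 h2
  rw [abs_le]
  constructor <;> linarith

theorem bddAbove_trace {n : ℕ} (A : Matrix (Fin n) (Fin n) ℝ)
    {S : Set (Matrix (Fin n) (Fin n) ℝ)} (hS : ∀ X ∈ S, X.PosSemidef ∧ ∀ i, X i i ≤ 1) :
    BddAbove ((fun X => (A * X).trace) '' S) := by
  refine ⟨∑ i, ∑ j, |A i j|, ?_⟩
  rintro _ ⟨X, hX, rfl⟩
  simp only [Matrix.trace, Matrix.diag_apply, Matrix.mul_apply]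
  refine Finset.sum_le_sum fun i _ => Finset.sum_le_sum fun j _ => ?_
  have h1 := abs_entry_le (hS X hX).1 j i
  have h2 := (hS X hX).2 i
  have h3 := (hS X hX).2 j
  calc A i j * X j i ≤ |A i j| * |X j i| := by rw [← abs_mul]; exact le_abs_self _
    _ ≤ |A i j| * 1 := by gcongr; linarith
    _ = |A i j| := mul_one _

theorem State.diag_le_one {n : ℕ} {X : Matrix (Fin n) (Fin n) ℝ} (hX : X ∈ State n) (i : Fin n) :
    X i i ≤ 1 := by
  rw [← hX.2]
  exact Finset.single_le_sum (f := fun i => X i i) (fun j _ => hX.1.diag_nonneg)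
    (Finset.mem_univ i)

theorem uniform_mem {n : ℕ} (hn : 0 < n) :
    (1 / (n : ℝ)) • (1 : Matrix (Fin n) (Fin n) ℝ) ∈ RenormFeasible n := by
  have h0 : (n : ℝ) ≠ 0 := by positivity
  refine ⟨⟨Matrix.PosSemidef.one.smul (by positivity), ?_⟩, fun i => by simp⟩
  simp [h0]

theorem RenormFeasible.subset {n : ℕ} {δ : ℝ} (hδ : 0 ≤ δ) :
    RenormFeasible n ⊆ ApproxFeasible n δ := fun X hX => ⟨hX.1, by simpa [hX.2] using hδ⟩

theorem isLUB_value {n : ℕ} (A : Matrix (Fin n) (Fin n) ℝ) :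
    IsLUB ((fun X => (A * X).trace) '' Feasible n) (value A) :=
  isLUB_csSup ⟨_, 1, ⟨Matrix.PosSemidef.one, fun i => by simp⟩, rfl⟩
    (bddAbove_trace A fun _ hX => ⟨hX.1, fun i => (hX.2 i).le⟩)

theorem isLUB_renormValue {n : ℕ} (hn : 0 < n) (A : Matrix (Fin n) (Fin n) ℝ) :
    IsLUB (renormObjective A '' RenormFeasible n) (renormValue A) :=
  isLUB_csSup ⟨_, _, uniform_mem hn, rfl⟩
    (bddAbove_trace _ fun _ hX => ⟨hX.1.1, fun i => State.diag_le_one hX.1 i⟩)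

theorem isLUB_relaxedValue {n : ℕ} (hn : 0 < n) {δ : ℝ} (hδ : 0 ≤ δ)
    (A : Matrix (Fin n) (Fin n) ℝ) :
    IsLUB (renormObjective A '' ApproxFeasible n δ) (relaxedValue δ A) :=
  isLUB_csSup ⟨_, _, RenormFeasible.subset hδ (uniform_mem hn), rfl⟩
    (bddAbove_trace _ fun _ hX => ⟨hX.1.1, fun i => State.diag_le_one hX.1 i⟩)

/-! ### The conversion of approximately feasible into feasible points -/

/-- The diagonal entry with index `i` deviates substantially from `1 / n`. -/
def Deviates {n : ℕ} (ε : ℝ) (ρ : Matrix (Fin n) (Fin n) ℝ) (i : Fin n) : Prop :=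
  ε ^ 2 / n < |ρ i i - 1 / (n : ℝ)|

open Classical in
/-- Set to zero all rows and columns whose diagonal entry deviates, and put `1 / n` on the
diagonal there. -/
def clearDeviating {n : ℕ} (ε : ℝ) (ρ : Matrix (Fin n) (Fin n) ℝ) : Matrix (Fin n) (Fin n) ℝ :=
  Matrix.of fun i j =>
    if Deviates ε ρ i ∨ Deviates ε ρ j then (if i = j then 1 / (n : ℝ) else 0) else ρ i j

/-- Replace all diagonal entries by `1 / n`. -/
def resetDiag {n : ℕ} (ρ : Matrix (Fin n) (Fin n) ℝ) : Matrix (Fin n) (Fin n) ℝ :=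
  Matrix.of fun i j => if i = j then 1 / (n : ℝ) else ρ i j

/-- The converted point `(1 + ε²)⁻¹ (R + (ε² / n) I)`, with `R` obtained from `ρ` by the two
steps above. -/
def convert {n : ℕ} (ε : ℝ) (ρ : Matrix (Fin n) (Fin n) ℝ) : Matrix (Fin n) (Fin n) ℝ :=
  (1 / (1 + ε ^ 2)) • (resetDiag (clearDeviating ε ρ) + (ε ^ 2 / n) • 1)

end MaxQP

/-! ### Programs for a real random access machine, with their running time -/

namespace RealRAM

/-- A configuration: registers for natural numbers (used as addresses and counters), registers
for real numbers, and an array of real memory cells. -/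
structure Config where
  idx : ℕ → ℕ
  reg : ℕ → ℝ
  mem : ℕ → ℝ

/-- Elementary instructions.  Register names are fixed in the program; the memory is addressed
indirectly, through the content of an index register. -/
inductive Instr where
  /-- `idx a := c` -/
  | iconst (a c : ℕ)
  /-- `idx a := idx b + idx c` -/
  | iadd (a b c : ℕ)
  /-- `idx a := idx b - idx c`, truncated at zero -/
  | isub (a b c : ℕ)
  /-- `reg a := q` -/
  | rconst (a : ℕ) (q : ℚ)
  /-- `reg a := idx b` -/
  | rcast (a b : ℕ)
  /-- `reg a := reg b + reg c` -/
  | radd (a b c : ℕ)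
  /-- `reg a := reg b - reg c` -/
  | rsub (a b c : ℕ)
  /-- `reg a := reg b * reg c` -/
  | rmul (a b c : ℕ)
  /-- `reg a := reg b / reg c` -/
  | rdiv (a b c : ℕ)
  /-- `reg a := mem (idx b)` -/
  | load (a b : ℕ)
  /-- `mem (idx a) := reg b` -/
  | store (a b : ℕ)

/-- The effect of an elementary instruction. -/
def Instr.apply (s : Config) : Instr → Config
  | .iconst a c => { s with idx := Function.update s.idx a c }
  | .iadd a b c => { s with idx := Function.update s.idx a (s.idx b + s.idx c) }
  | .isub a b c => { s with idx := Function.update s.idx a (s.idx b - s.idx c) }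
  | .rconst a q => { s with reg := Function.update s.reg a (q : ℝ) }
  | .rcast a b => { s with reg := Function.update s.reg a (s.idx b : ℝ) }
  | .radd a b c => { s with reg := Function.update s.reg a (s.reg b + s.reg c) }
  | .rsub a b c => { s with reg := Function.update s.reg a (s.reg b - s.reg c) }
  | .rmul a b c => { s with reg := Function.update s.reg a (s.reg b * s.reg c) }
  | .rdiv a b c => { s with reg := Function.update s.reg a (s.reg b / s.reg c) }
  | .load a b => { s with reg := Function.update s.reg a (s.mem (s.idx b)) }
  | .store a b => { s with mem := Function.update s.mem (s.idx a) (s.reg b) }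

/-- Elementary tests. -/
inductive Test where
  /-- `idx a < idx b` -/
  | ilt (a b : ℕ)
  /-- `reg a < reg b` -/
  | rlt (a b : ℕ)

/-- The truth of an elementary test. -/
def Test.Holds (s : Config) : Test → Prop
  | .ilt a b => s.idx a < s.idx b
  | .rlt a b => s.reg a < s.reg b

/-- Programs, built from elementary instructions by sequencing, branching and loops. -/
inductive Program where
  | skip
  | instr (c : Instr)
  | seq (p q : Program)
  | ite (b : Test) (p q : Program)
  | while (b : Test) (p : Program)

/-- `Exec p s s' t`: started in configuration `s`, the program `p` halts in configuration `s'`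
after `t` steps.  Every elementary instruction and every evaluation of a test is one step. -/
inductive Exec : Program → Config → Config → ℕ → Prop where
  | skip (s : Config) : Exec .skip s s 0
  | instr (c : Instr) (s : Config) : Exec (.instr c) s (c.apply s) 1
  | seq {p q : Program} {s s' s'' : Config} {t t' : ℕ} :
      Exec p s s' t → Exec q s' s'' t' → Exec (.seq p q) s s'' (t + t')
  | ite_true {b : Test} {p q : Program} {s s' : Config} {t : ℕ} :
      b.Holds s → Exec p s s' t → Exec (.ite b p q) s s' (t + 1)
  | ite_false {b : Test} {p q : Program} {s s' : Config} {t : ℕ} :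
      ¬ b.Holds s → Exec q s s' t → Exec (.ite b p q) s s' (t + 1)
  | while_true {b : Test} {p : Program} {s s' s'' : Config} {t t' : ℕ} :
      b.Holds s → Exec p s s' t → Exec (.while b p) s' s'' t' →
        Exec (.while b p) s s'' (t + t' + 1)
  | while_false {b : Test} {p : Program} {s : Config} :
      ¬ b.Holds s → Exec (.while b p) s s 1

/-- The initial configuration for the input `(n, ε, ρ)`: the dimension is in index register `0`,
the accuracy in real register `0`, the entries of the matrix row by row in the memory cells
`0, …, n² - 1`; everything else is zero. -/
def input {n : ℕ} (ε : ℝ) (ρ : Matrix (Fin n) (Fin n) ℝ) : Config where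
  idx a := if a = 0 then n else 0
  reg a := if a = 0 then ε else 0
  mem k := if h : k < n * n then ρ (finProdFinEquiv.symm ⟨k, h⟩).1 (finProdFinEquiv.symm ⟨k, h⟩).2
    else 0

/-- The configuration `s` holds the matrix `X`, row by row, in the memory cells
`0, …, n² - 1`. -/
def Holds {n : ℕ} (s : Config) (X : Matrix (Fin n) (Fin n) ℝ) : Prop :=
  ∀ i j : Fin n, s.mem (i * n + j) = X i j

/-- On input `(n, ε, ρ)` the program `p` halts within `T` steps and then holds the matrix `X`. -/
def ComputesWithin {n : ℕ} (p : Program) (T : ℕ) (ε : ℝ) (ρ X : Matrix (Fin n) (Fin n) ℝ) : Prop :=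
  ∃ s t, Exec p (input ε ρ) s t ∧ t ≤ T ∧ Holds s X

end RealRAM

end

/-! ### Trace inequalities via Gram factorizations -/

namespace MaxQP

open Matrix

variable {n : ℕ}

/-! Everything rests on the rounding map `convert`. It sends a positive semidefinite matrix to an
exactly feasible point of the renormalized SDP, and it moves the objective of an `ε ^
4`-approximately feasible state by at most `7 * ε`.

Write `ρ = Bᵀ * B`. Deleting the rows and columns of `ρ` in a set amounts to deleting columns of
`B`, so positivity survives. The remaining change is diagonal; the added `ε ^ 2 / n` makes it
nonnegative, since the surviving diagonal entries are within `ε ^ 2 / n` of `1 / n` (`convert_gram`,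
`correction_nonneg`).

By a Markov argument the deleted indices carry diagonal mass of order `ε ^ 2` when `ε ≤ 1`.
Cauchy–Schwarz costs a square root, so the deletion changes the trace by order `ε * opNorm A`
(`abs_trace_sub_clearOn_le`); this is why accuracy `ε ^ 4` yields error `ε`. For `ε > 1` the bound
is trivial because objectives of states lie in `[-1, 1]`.

Hence relaxing the constraints gains at most `7 * ε`, and `value_eq` transfers the estimates to the
original SDP by the scaling `X ↦ n X`. For the running time, off the diagonal `n • convert ε ρ` is
`ρ` times a constant and a 0/1 flag for the row and for the column: linearly many flag computations
and one pass over the matrix suffice. -/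

theorem opNorm_nonneg (A : Matrix (Fin n) (Fin n) ℝ) : 0 ≤ opNorm A := norm_nonneg _

theorem eq_zero_of_opNorm_eq_zero {A : Matrix (Fin n) (Fin n) ℝ} (h : opNorm A = 0) : A = 0 := by
  have h1 : Matrix.toEuclideanCLM (n := Fin n) (𝕜 := ℝ) A = 0 := norm_eq_zero.mp h
  exact (map_eq_zero_iff _ (Matrix.toEuclideanCLM (n := Fin n) (𝕜 := ℝ)).injective).mp h1

theorem abs_dotProduct_mulVec_le (A : Matrix (Fin n) (Fin n) ℝ) (x y : Fin n → ℝ) :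
    |x ⬝ᵥ A *ᵥ y| ≤ opNorm A * (‖WithLp.toLp 2 x‖ * ‖WithLp.toLp 2 y‖) := by
  have h1 : x ⬝ᵥ A *ᵥ y = inner ℝ (WithLp.toLp 2 x)
      (Matrix.toEuclideanCLM (n := Fin n) (𝕜 := ℝ) A (WithLp.toLp 2 y)) := by
    rw [Matrix.toEuclideanCLM_toLp, EuclideanSpace.inner_toLp_toLp, dotProduct_comm]
    simp
  rw [h1]
  calc _ ≤ ‖WithLp.toLp 2 x‖ * ‖Matrix.toEuclideanCLM (n := Fin n) (𝕜 := ℝ) A (WithLp.toLp 2 y)‖ :=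
        abs_real_inner_le_norm _ _
    _ ≤ ‖WithLp.toLp 2 x‖ * (opNorm A * ‖WithLp.toLp 2 y‖) := by
        gcongr
        exact ContinuousLinearMap.le_opNorm _ _
    _ = _ := by ring

theorem norm_toLp_sq (x : Fin n → ℝ) : ‖WithLp.toLp 2 x‖ ^ 2 = ∑ i, x i ^ 2 := by
  simp [EuclideanSpace.norm_sq_eq]

theorem abs_diag_le (A : Matrix (Fin n) (Fin n) ℝ) (i : Fin n) : |A i i| ≤ opNorm A := by
  have h := abs_dotProduct_mulVec_le A (Pi.single i 1) (Pi.single i 1)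
  have h1 : ‖WithLp.toLp 2 (Pi.single i (1 : ℝ) : Fin n → ℝ)‖ = 1 := by
    rw [← sq_eq_sq₀ (norm_nonneg _) zero_le_one, norm_toLp_sq]
    simp [Pi.single_apply]
  simpa [h1] using h

theorem abs_trace_mul_diagonal_le (A : Matrix (Fin n) (Fin n) ℝ) (d : Fin n → ℝ) :
    |(A * Matrix.diagonal d).trace| ≤ opNorm A * ∑ i, |d i| := by
  simp only [Matrix.trace, Matrix.diag_apply, Matrix.mul_diagonal]
  refine (Finset.abs_sum_le_sum_abs _ _).trans ?_
  rw [Finset.mul_sum]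
  gcongr with i
  rw [abs_mul]
  gcongr
  exact abs_diag_le A i

theorem trace_mul_gram (A B : Matrix (Fin n) (Fin n) ℝ) :
    (A * (Bᵀ * B)).trace = ∑ k, B k ⬝ᵥ A *ᵥ B k := by
  rw [← Matrix.mul_assoc, Matrix.trace_mul_comm]
  simp only [Matrix.trace, Matrix.diag_apply, Matrix.mul_apply, dotProduct, Matrix.mulVec,
    Matrix.transpose_apply]

theorem trace_gram (B : Matrix (Fin n) (Fin n) ℝ) :
    (Bᵀ * B).trace = ∑ k, ‖WithLp.toLp 2 (B k)‖ ^ 2 := by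
  simp_rw [norm_toLp_sq]
  simpa [dotProduct, sq] using trace_mul_gram 1 B

open scoped MatrixOrder in
theorem PosSemidef.exists_gram {X : Matrix (Fin n) (Fin n) ℝ} (hX : X.PosSemidef) :
    ∃ B : Matrix (Fin n) (Fin n) ℝ, X = Bᵀ * B := by
  obtain ⟨B, hB⟩ := CStarAlgebra.nonneg_iff_eq_star_mul_self.mp hX.nonneg
  exact ⟨B, by simpa [Matrix.star_eq_conjTranspose] using hB⟩

theorem posSemidef_gram (B : Matrix (Fin n) (Fin n) ℝ) : (Bᵀ * B).PosSemidef := by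
  simpa using Matrix.posSemidef_conjTranspose_mul_self B

/-- The trace is a sum of quadratic forms in the rows of a Gram factor, whose squared norms add up
to `X.trace`. -/
theorem abs_trace_mul_le (A : Matrix (Fin n) (Fin n) ℝ) {X : Matrix (Fin n) (Fin n) ℝ}
    (hX : X.PosSemidef) : |(A * X).trace| ≤ opNorm A * X.trace := by
  obtain ⟨B, rfl⟩ := PosSemidef.exists_gram hX
  rw [trace_mul_gram, trace_gram, Finset.mul_sum]
  refine (Finset.abs_sum_le_sum_abs _ _).trans ?_
  gcongr with k
  rw [sq]
  exact abs_dotProduct_mulVec_le A _ _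

/-! ### Deleting columns of a Gram factor -/

/-- Set to zero the columns of `B` with index in `S`. -/
def clearOn (S : Finset (Fin n)) (B : Matrix (Fin n) (Fin n) ℝ) : Matrix (Fin n) (Fin n) ℝ :=
  Matrix.of fun k i => if i ∈ S then 0 else B k i

theorem gram_clearOn_apply (S : Finset (Fin n)) (B : Matrix (Fin n) (Fin n) ℝ) (i j : Fin n) :
    ((clearOn S B)ᵀ * clearOn S B) i j = if i ∈ S ∨ j ∈ S then 0 else (Bᵀ * B) i j := by
  simp only [Matrix.mul_apply, Matrix.transpose_apply, clearOn, Matrix.of_apply]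
  by_cases hi : i ∈ S <;> by_cases hj : j ∈ S <;> simp [hi, hj]

theorem trace_gram_clearOn_le (S : Finset (Fin n)) (B : Matrix (Fin n) (Fin n) ℝ) :
    ((clearOn S B)ᵀ * clearOn S B).trace ≤ (Bᵀ * B).trace := by
  simp only [Matrix.trace, Matrix.diag_apply, gram_clearOn_apply]
  refine Finset.sum_le_sum fun i _ => ?_
  split_ifs
  · exact (posSemidef_gram B).diag_nonneg
  · exact le_rfl

/-- Change one argument of the form at a time, then apply the weighted inequality `2xy ≤ εx² +
y²/ε`. The weight is chosen so that a removed mass of order `ε ^ 2` costs order `ε`. -/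
theorem abs_quadratic_sub_le (A : Matrix (Fin n) (Fin n) ℝ) {ε : ℝ} (hε : 0 < ε)
    (b c : Fin n → ℝ) (hcb : ‖WithLp.toLp 2 c‖ ≤ ‖WithLp.toLp 2 b‖) :
    |b ⬝ᵥ A *ᵥ b - c ⬝ᵥ A *ᵥ c| ≤
      opNorm A * (ε * ‖WithLp.toLp 2 b‖ ^ 2 + ‖WithLp.toLp 2 (b - c)‖ ^ 2 / ε) := by
  have h1 : b ⬝ᵥ A *ᵥ b - c ⬝ᵥ A *ᵥ c = b ⬝ᵥ A *ᵥ (b - c) + (b - c) ⬝ᵥ A *ᵥ c := by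
    simp only [Matrix.mulVec_sub, dotProduct_sub, sub_dotProduct]
    ring
  have h2 := abs_dotProduct_mulVec_le A b (b - c)
  have h3 := abs_dotProduct_mulVec_le A (b - c) c
  set x := ‖WithLp.toLp 2 b‖
  set y := ‖WithLp.toLp 2 (b - c)‖
  have hA := opNorm_nonneg A
  have hy : 0 ≤ y := norm_nonneg _
  have h4 : 2 * (x * y) ≤ ε * x ^ 2 + y ^ 2 / ε := by
    have : ε * x ^ 2 + y ^ 2 / ε - 2 * (x * y) = (ε * x - y) ^ 2 / ε := by
      field_simp
      ring
    have : 0 ≤ (ε * x - y) ^ 2 / ε := by positivity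
    linarith
  calc _ ≤ opNorm A * (x * y) + opNorm A * (y * ‖WithLp.toLp 2 c‖) := by
        rw [h1]
        exact (abs_add_le _ _).trans (add_le_add h2 h3)
    _ ≤ opNorm A * (x * y) + opNorm A * (y * x) := by gcongr
    _ = opNorm A * (2 * (x * y)) := by ring
    _ ≤ _ := by gcongr

/-- Sum the quadratic estimate over the rows of `B`: the squared norms of the rows give the trace,
those of the removed parts give the diagonal mass on `S`. -/
theorem abs_trace_sub_clearOn_le (A B : Matrix (Fin n) (Fin n) ℝ) (S : Finset (Fin n)) {ε : ℝ}
    (hε : 0 < ε) :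
    |(A * (Bᵀ * B)).trace - (A * ((clearOn S B)ᵀ * clearOn S B)).trace| ≤
      opNorm A * (ε * (Bᵀ * B).trace + (∑ i ∈ S, (Bᵀ * B) i i) / ε) := by
  have hS : ∑ i ∈ S, (Bᵀ * B) i i = ∑ k, ‖WithLp.toLp 2 (B k - clearOn S B k)‖ ^ 2 := by
    simp only [norm_toLp_sq]
    rw [Finset.sum_comm, ← Finset.sum_filter_add_sum_filter_not Finset.univ (· ∈ S)]
    simp only [Finset.filter_univ_mem]
    rw [Finset.sum_eq_zero (s := Finset.univ.filter (· ∉ S)), add_zero]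
    · refine Finset.sum_congr rfl fun i hi => ?_
      simp [Matrix.mul_apply, clearOn, hi, sq]
    · intro i hi
      simp only [Finset.mem_filter, Finset.mem_univ, true_and] at hi
      simp [clearOn, hi]
  rw [trace_mul_gram, trace_mul_gram, ← Finset.sum_sub_distrib, hS, trace_gram, Finset.mul_sum,
    Finset.sum_div, ← Finset.sum_add_distrib, Finset.mul_sum]
  refine (Finset.abs_sum_le_sum_abs _ _).trans (Finset.sum_le_sum fun k _ => ?_)
  refine abs_quadratic_sub_le A hε _ _ ?_
  rw [← sq_le_sq₀ (norm_nonneg _) (norm_nonneg _), norm_toLp_sq, norm_toLp_sq]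
  refine Finset.sum_le_sum fun i _ => ?_
  simp only [clearOn, Matrix.of_apply]
  split_ifs
  · simpa using sq_nonneg (B k i)
  · exact le_rfl

/-! ### Exact feasibility of the rounded matrix -/

open Classical in
/-- The set of indices at which the diagonal deviates. -/
noncomputable def deviating (ε : ℝ) (ρ : Matrix (Fin n) (Fin n) ℝ) : Finset (Fin n) :=
  Finset.univ.filter (Deviates ε ρ)

theorem mem_deviating {ε : ℝ} {ρ : Matrix (Fin n) (Fin n) ℝ} {i : Fin n} :
    i ∈ deviating ε ρ ↔ Deviates ε ρ i := by simp [deviating]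

/-- The diagonal correction that makes the cleared matrix feasible up to normalization. -/
noncomputable def correction (ε : ℝ) (ρ : Matrix (Fin n) (Fin n) ℝ) (i : Fin n) : ℝ :=
  if i ∈ deviating ε ρ then 1 / (n : ℝ) + ε ^ 2 / n else 1 / (n : ℝ) - ρ i i + ε ^ 2 / n

/-- This form exhibits the rounded matrix as a Gram matrix plus a diagonal one, from which both
positivity and the error estimate follow. -/
theorem convert_gram (ε : ℝ) (B : Matrix (Fin n) (Fin n) ℝ) :
    convert ε (Bᵀ * B) = (1 / (1 + ε ^ 2)) •
      ((clearOn (deviating ε (Bᵀ * B)) B)ᵀ * clearOn (deviating ε (Bᵀ * B)) B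
        + Matrix.diagonal (correction ε (Bᵀ * B))) := by
  unfold convert
  congr 1
  ext i j
  simp only [Matrix.add_apply, gram_clearOn_apply, resetDiag, clearDeviating, Matrix.of_apply,
    mem_deviating, Matrix.smul_apply, Matrix.one_apply, Matrix.diagonal_apply, correction]
  by_cases hij : i = j
  · subst hij
    by_cases h : Deviates ε (Bᵀ * B) i
    · simp [h, mem_deviating]
    · simp only [h, mem_deviating, if_true, if_false, or_self, smul_eq_mul]
      ring
  · by_cases h : Deviates ε (Bᵀ * B) i <;> by_cases h' : Deviates ε (Bᵀ * B) j <;>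
      simp [h, h', hij, mem_deviating]

theorem correction_nonneg (ε : ℝ) (ρ : Matrix (Fin n) (Fin n) ℝ) (i : Fin n) :
    0 ≤ correction ε ρ i := by
  unfold correction
  split_ifs with h
  · positivity
  · rw [mem_deviating, Deviates, not_lt] at h
    have := (abs_le.mp h).2
    linarith

theorem posSemidef_convert (ε : ℝ) {ρ : Matrix (Fin n) (Fin n) ℝ} (hρ : ρ.PosSemidef) :
    (convert ε ρ).PosSemidef := by
  obtain ⟨B, rfl⟩ := PosSemidef.exists_gram hρ
  rw [convert_gram]
  exact ((posSemidef_gram _).add (Matrix.PosSemidef.diagonal (correction_nonneg ε _))).smul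
    (by positivity)

theorem convert_diag (ε : ℝ) (ρ : Matrix (Fin n) (Fin n) ℝ) (i : Fin n) :
    convert ε ρ i i = 1 / (n : ℝ) := by
  have h : 1 + ε ^ 2 ≠ 0 := by positivity
  simp only [convert, resetDiag, Matrix.smul_apply, Matrix.add_apply, Matrix.of_apply,
    Matrix.one_apply_eq, smul_eq_mul, if_true]
  field_simp

theorem smul_mem_feasible (hn : 0 < n) {X : Matrix (Fin n) (Fin n) ℝ} (hX : X.PosSemidef)
    (h : ∀ i, X i i = 1 / (n : ℝ)) : (n : ℝ) • X ∈ Feasible n := by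
  have h0 : (n : ℝ) ≠ 0 := by positivity
  exact ⟨hX.smul (by positivity), fun i => by simp [h, h0]⟩

theorem mem_renormFeasible (hn : 0 < n) {X : Matrix (Fin n) (Fin n) ℝ} (hX : X.PosSemidef)
    (h : ∀ i, X i i = 1 / (n : ℝ)) : X ∈ RenormFeasible n := by
  have h0 : (n : ℝ) ≠ 0 := by positivity
  exact ⟨⟨hX, by simp [Matrix.trace, h, h0]⟩, h⟩

theorem convert_mem_renormFeasible (hn : 0 < n) (ε : ℝ) {ρ : Matrix (Fin n) (Fin n) ℝ}
    (hρ : ρ.PosSemidef) : convert ε ρ ∈ RenormFeasible n :=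
  mem_renormFeasible hn (posSemidef_convert ε hρ) (convert_diag ε ρ)

/-! ### Error budget of the rounding -/

/-- Markov's inequality: each deviating index uses more than `ε ^ 2 / n` of the total deviation `ε ^
4`. -/
theorem card_deviating_le {ε : ℝ} (hε : 0 < ε) {ρ : Matrix (Fin n) (Fin n) ℝ}
    (h : ∑ i, |ρ i i - 1 / (n : ℝ)| ≤ ε ^ 4) : (deviating ε ρ).card * (1 / (n : ℝ)) ≤ ε ^ 2 := by
  have h1 : (deviating ε ρ).card * (ε ^ 2 / (n : ℝ)) ≤ ε ^ 4 := by
    calc _ = ∑ i ∈ deviating ε ρ, ε ^ 2 / (n : ℝ) := by simp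
      _ ≤ ∑ i ∈ deviating ε ρ, |ρ i i - 1 / (n : ℝ)| :=
          Finset.sum_le_sum fun i hi => (mem_deviating.mp hi).le
      _ ≤ ∑ i, |ρ i i - 1 / (n : ℝ)| :=
          Finset.sum_le_sum_of_subset_of_nonneg (Finset.subset_univ _) fun _ _ _ => abs_nonneg _
      _ ≤ ε ^ 4 := h
  have h2 : ε ^ 2 * ((deviating ε ρ).card * (1 / (n : ℝ))) ≤ ε ^ 2 * ε ^ 2 := by
    calc _ = (deviating ε ρ).card * (ε ^ 2 / (n : ℝ)) := by ring
      _ ≤ _ := h1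
      _ = _ := by ring
  exact le_of_mul_le_mul_left h2 (by positivity)

theorem sum_deviating_le {ε : ℝ} (hε : 0 < ε) {ρ : Matrix (Fin n) (Fin n) ℝ}
    (h : ∑ i, |ρ i i - 1 / (n : ℝ)| ≤ ε ^ 4) :
    ∑ i ∈ deviating ε ρ, ρ i i ≤ ε ^ 2 + ε ^ 4 := by
  calc _ ≤ ∑ i ∈ deviating ε ρ, (1 / (n : ℝ) + |ρ i i - 1 / (n : ℝ)|) :=
        Finset.sum_le_sum fun i _ => by linarith [le_abs_self (ρ i i - 1 / (n : ℝ))]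
    _ = (deviating ε ρ).card * (1 / (n : ℝ)) + ∑ i ∈ deviating ε ρ, |ρ i i - 1 / (n : ℝ)| := by
        simp [Finset.sum_add_distrib]
    _ ≤ (deviating ε ρ).card * (1 / (n : ℝ)) + ∑ i, |ρ i i - 1 / (n : ℝ)| := by
        gcongr
        exact Finset.subset_univ _
    _ ≤ _ := add_le_add (card_deviating_le hε h) h

theorem sum_correction_le {ε : ℝ} (hε : 0 < ε) (hn : 0 < n) {ρ : Matrix (Fin n) (Fin n) ℝ}
    (h : ∑ i, |ρ i i - 1 / (n : ℝ)| ≤ ε ^ 4) :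
    ∑ i, |correction ε ρ i| ≤ 2 * ε ^ 2 + ε ^ 4 := by
  have h0 : (n : ℝ) ≠ 0 := by positivity
  calc _ ≤ ∑ i, ((if i ∈ deviating ε ρ then 1 / (n : ℝ) else 0) + |ρ i i - 1 / (n : ℝ)|
          + ε ^ 2 / n) := by
        refine Finset.sum_le_sum fun i _ => ?_
        rw [abs_of_nonneg (correction_nonneg ε ρ i)]
        have h1 := neg_abs_le (ρ i i - 1 / (n : ℝ))
        unfold correction
        split_ifs <;> linarith [abs_nonneg (ρ i i - 1 / (n : ℝ))]
    _ = (deviating ε ρ).card * (1 / (n : ℝ)) + ∑ i, |ρ i i - 1 / (n : ℝ)| + ε ^ 2 := by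
        simp only [Finset.sum_add_distrib, Finset.sum_ite_mem, Finset.univ_inter,
          Finset.sum_const, nsmul_eq_mul, Finset.card_univ, Fintype.card_fin]
        congr 1
        field_simp
    _ ≤ _ := by linarith [card_deviating_le hε h]

/-- The constant is `7 = 3 + 3 + 1`: deleting columns, the diagonal correction, and the
normalization by `1 + ε ^ 2`. -/
theorem abs_trace_sub_convert_le_of_le_one (A : Matrix (Fin n) (Fin n) ℝ) (hn : 0 < n) {ε : ℝ}
    (hε : 0 < ε) (hε1 : ε ≤ 1) {ρ : Matrix (Fin n) (Fin n) ℝ}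
    (hρ : ρ ∈ ApproxFeasible n (ε ^ 4)) :
    |(A * ρ).trace - (A * convert ε ρ).trace| ≤ 7 * ε * opNorm A := by
  obtain ⟨⟨hpsd, htr⟩, hdev⟩ := hρ
  obtain ⟨B, rfl⟩ := PosSemidef.exists_gram hpsd
  have hA := opNorm_nonneg A
  have h1 := abs_trace_sub_clearOn_le A B (deviating ε (Bᵀ * B)) hε
  have h2 := abs_trace_mul_diagonal_le A (correction ε (Bᵀ * B))
  have h3 := abs_trace_mul_le A (posSemidef_gram (clearOn (deviating ε (Bᵀ * B)) B))
  have h4 := trace_gram_clearOn_le (deviating ε (Bᵀ * B)) B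
  have h5 := sum_correction_le hε hn hdev
  have h6 := sum_deviating_le hε hdev
  rw [convert_gram, Matrix.mul_smul, Matrix.trace_smul, Matrix.mul_add, Matrix.trace_add,
    smul_eq_mul]
  rw [htr] at h1 h4
  set t := (A * ((clearOn (deviating ε (Bᵀ * B)) B)ᵀ * clearOn (deviating ε (Bᵀ * B)) B)).trace
  set r := (A * (Bᵀ * B)).trace
  set d := (A * Matrix.diagonal (correction ε (Bᵀ * B))).trace
  have e2 : ε ^ 2 ≤ ε := by nlinarith
  have e4 : ε ^ 4 ≤ ε ^ 2 := by nlinarith [sq_nonneg ε]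
  have h1' : |r - t| ≤ opNorm A * (3 * ε) := by
    refine h1.trans ?_
    gcongr
    have : (∑ i ∈ deviating ε (Bᵀ * B), (Bᵀ * B) i i) / ε ≤ 2 * ε := by
      rw [div_le_iff₀ hε]
      nlinarith
    linarith
  have h2' : |d| ≤ opNorm A * (3 * ε) := h2.trans (by gcongr; linarith)
  have h3' : |t| ≤ opNorm A := h3.trans (mul_le_of_le_one_right hA h4)
  have hpos : 0 < 1 + ε ^ 2 := by positivity
  -- Separates the three sources of error: deletion, normalization, correction.
  have key : r - 1 / (1 + ε ^ 2) * (t + d) =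
      (r - t) + (ε ^ 2 / (1 + ε ^ 2)) * t - (1 / (1 + ε ^ 2)) * d := by
    field_simp
    ring
  have k1 : |(ε ^ 2 / (1 + ε ^ 2)) * t| ≤ ε * opNorm A := by
    rw [abs_mul, abs_of_nonneg (by positivity : 0 ≤ ε ^ 2 / (1 + ε ^ 2))]
    gcongr
    rw [div_le_iff₀ hpos]
    nlinarith
  have k2 : |(1 / (1 + ε ^ 2)) * d| ≤ |d| := by
    rw [abs_mul, abs_of_nonneg (by positivity : 0 ≤ 1 / (1 + ε ^ 2))]
    refine mul_le_of_le_one_left (abs_nonneg _) ?_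
    rw [div_le_one hpos]
    nlinarith
  rw [key]
  calc _ ≤ |r - t| + |(ε ^ 2 / (1 + ε ^ 2)) * t| + |(1 / (1 + ε ^ 2)) * d| :=
        (abs_sub _ _).trans (by gcongr; exact abs_add_le _ _)
    _ ≤ _ := by linarith

/-! ### Comparison of the optimal values -/

theorem renormObjective_eq (A X : Matrix (Fin n) (Fin n) ℝ) :
    renormObjective A X = (A * X).trace / opNorm A := by
  simp only [renormObjective, Matrix.smul_mul, Matrix.trace_smul, smul_eq_mul]
  ring

theorem renormObjective_mul_opNorm (A X : Matrix (Fin n) (Fin n) ℝ) :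
    renormObjective A X * opNorm A = (A * X).trace := by
  rw [renormObjective_eq]
  by_cases h : opNorm A = 0
  · simp [eq_zero_of_opNorm_eq_zero h]
  · field_simp

theorem abs_renormObjective_le_one (A : Matrix (Fin n) (Fin n) ℝ) {X : Matrix (Fin n) (Fin n) ℝ}
    (hX : X ∈ State n) : |renormObjective A X| ≤ 1 := by
  rw [renormObjective_eq, abs_div, abs_of_nonneg (opNorm_nonneg A)]
  -- Division by zero gives `0`, so `A = 0` needs no separate case.
  refine div_le_one_of_le₀ ?_ (opNorm_nonneg A)
  simpa [hX.2] using abs_trace_mul_le A hX.1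

theorem abs_renormObjective_sub_convert_le (A : Matrix (Fin n) (Fin n) ℝ) (hn : 0 < n) {ε : ℝ}
    (hε : 0 < ε) {ρ : Matrix (Fin n) (Fin n) ℝ} (hρ : ρ ∈ ApproxFeasible n (ε ^ 4)) :
    |renormObjective A ρ - renormObjective A (convert ε ρ)| ≤ 7 * ε := by
  rcases le_or_gt ε 1 with h | h
  · rw [renormObjective_eq, renormObjective_eq, ← sub_div, abs_div,
      abs_of_nonneg (opNorm_nonneg A)]
    exact div_le_of_le_mul₀ (opNorm_nonneg A) (by positivity)
      (abs_trace_sub_convert_le_of_le_one A hn hε h hρ)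
  · have h1 := abs_le.mp (abs_renormObjective_le_one A hρ.1)
    have h2 := abs_le.mp
      (abs_renormObjective_le_one A (convert_mem_renormFeasible hn ε hρ.1.1).1)
    rw [abs_le]
    constructor <;> linarith [h1.1, h1.2, h2.1, h2.2]

theorem abs_renormValue_le_one (hn : 0 < n) (A : Matrix (Fin n) (Fin n) ℝ) :
    |renormValue A| ≤ 1 := by
  have h := isLUB_renormValue hn A
  rw [abs_le]
  constructor
  · exact (abs_le.mp (abs_renormObjective_le_one A (uniform_mem hn).1)).1.trans
      (h.1 ⟨_, uniform_mem hn, rfl⟩)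
  · refine h.2 ?_
    rintro _ ⟨X, hX, rfl⟩
    exact (abs_le.mp (abs_renormObjective_le_one A hX.1)).2

theorem value_eq (hn : 0 < n) (A : Matrix (Fin n) (Fin n) ℝ) :
    value A = renormValue A * (n * opNorm A) := by
  have h0 : (0 : ℝ) < n := by positivity
  have hA := opNorm_nonneg A
  have h1 := isLUB_renormValue hn A
  have h2 := isLUB_value A
  have hle : value A ≤ renormValue A * (n * opNorm A) := by
    refine h2.2 ?_
    rintro _ ⟨X, hX, rfl⟩
    have hm : (1 / (n : ℝ)) • X ∈ RenormFeasible n :=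
      mem_renormFeasible hn (hX.1.smul (by positivity)) fun i => by simp [hX.2]
    have h3 : renormObjective A ((1 / (n : ℝ)) • X) ≤ renormValue A := h1.1 ⟨_, hm, rfl⟩
    have h4 := renormObjective_mul_opNorm A ((1 / (n : ℝ)) • X)
    rw [Matrix.mul_smul, Matrix.trace_smul, smul_eq_mul] at h4
    calc (A * X).trace = n * (1 / (n : ℝ) * (A * X).trace) := by field_simp
      _ = renormObjective A ((1 / (n : ℝ)) • X) * (n * opNorm A) := by rw [← h4]; ring
      _ ≤ _ := by gcongr
  refine le_antisymm hle ?_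
  -- When `A = 0` one cannot divide by `n * opNorm A`; the right side is then `0`, and the identity
  -- matrix shows that the value is nonnegative.
  rcases hA.eq_or_lt with h | h
  · rw [eq_zero_of_opNorm_eq_zero h.symm]
    have : (0 : ℝ) ≤ value (0 : Matrix (Fin n) (Fin n) ℝ) :=
      (isLUB_value 0).1 ⟨1, ⟨Matrix.PosSemidef.one, fun i => by simp⟩, by simp⟩
    simpa [opNorm] using this
  · rw [← le_div_iff₀ (by positivity)]
    refine h1.2 ?_
    rintro _ ⟨X, hX, rfl⟩
    have h3 : (A * ((n : ℝ) • X)).trace ≤ value A :=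
      h2.1 ⟨_, smul_mem_feasible hn hX.1.1 hX.2, rfl⟩
    rw [le_div_iff₀ (by positivity)]
    calc _ = n * (renormObjective A X * opNorm A) := by ring
      _ = (A * ((n : ℝ) • X)).trace := by
          rw [renormObjective_mul_opNorm, Matrix.mul_smul, Matrix.trace_smul, smul_eq_mul]
      _ ≤ _ := h3

theorem renormObjective_le (A : Matrix (Fin n) (Fin n) ℝ) (hn : 0 < n) {ε : ℝ}
    (hε : 0 < ε) {ρ : Matrix (Fin n) (Fin n) ℝ} (hρ : ρ ∈ ApproxFeasible n (ε ^ 4)) :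
    renormObjective A ρ ≤ renormValue A + 7 * ε := by
  have h1 := (abs_le.mp (abs_renormObjective_sub_convert_le A hn hε hρ)).2
  have h2 : renormObjective A (convert ε ρ) ≤ renormValue A :=
    (isLUB_renormValue hn A).1 ⟨_, convert_mem_renormFeasible hn ε hρ.1.1, rfl⟩
  linarith

theorem abs_relaxedValue_sub_le (A : Matrix (Fin n) (Fin n) ℝ) (hn : 0 < n) {ε : ℝ}
    (hε : 0 < ε) : |relaxedValue (ε ^ 4) A - renormValue A| ≤ 7 * ε := by
  have h := isLUB_relaxedValue hn (by positivity : 0 ≤ ε ^ 4) A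
  have h1 : renormValue A ≤ relaxedValue (ε ^ 4) A :=
    (isLUB_renormValue hn A).mono h (Set.image_mono (RenormFeasible.subset (by positivity)))
  have h2 : relaxedValue (ε ^ 4) A ≤ renormValue A + 7 * ε := by
    refine h.2 ?_
    rintro _ ⟨X, hX, rfl⟩
    exact renormObjective_le A hn hε hX
  rw [abs_le]
  constructor <;> linarith

theorem abs_renormObjective_sub_le {A : Matrix (Fin n) (Fin n) ℝ} (hn : 0 < n) {ε : ℝ}
    (hε : 0 < ε) {ρ : Matrix (Fin n) (Fin n) ℝ} (hρ : IsApproxSolution (ε ^ 4) A ρ) :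
    |renormObjective A ρ - renormValue A| ≤ 7 * ε := by
  have h1 := renormObjective_le A hn hε hρ.1
  have h2 := (abs_le.mp (abs_renormObjective_le_one A hρ.1.1)).1
  have h3 := (abs_le.mp (abs_renormValue_le_one hn A)).2
  rw [abs_le]
  refine ⟨?_, by linarith⟩
  -- The permitted loss `ε ^ 4` is at most `ε` only for `ε ≤ 1`; beyond that, both quantities lie in
  -- `[-1, 1]`.
  rcases le_or_gt ε 1 with h | h
  · have : ε ^ 4 ≤ ε := pow_le_of_le_one hε.le h (by norm_num)
    linarith [hρ.2]
  · linarith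

theorem abs_mul_sub_value_le {A : Matrix (Fin n) (Fin n) ℝ} (hn : 0 < n) {ε x c : ℝ}
    (h : |x - renormValue A| ≤ c * ε) :
    |x * (n * opNorm A) - value A| ≤ c * (ε * n * opNorm A) := by
  have hA := opNorm_nonneg A
  rw [value_eq hn, ← sub_mul, abs_mul, abs_of_nonneg (by positivity : 0 ≤ n * opNorm A)]
  calc _ ≤ c * ε * (n * opNorm A) := by gcongr
    _ = _ := by ring

end MaxQP

/-! ### Execution rules and addressing -/

namespace RealRAM

/-- A sequence of elementary instructions. -/
def block : List Instr → Program
  | [] => .skip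
  | c :: l => .seq (.instr c) (block l)

theorem exec_block (l : List Instr) (s : Config) :
    Exec (block l) s (l.foldl Instr.apply s) l.length := by
  induction l generalizing s with
  | nil => exact .skip s
  | cons c l ih =>
    rw [List.length_cons, Nat.add_comm]
    exact .seq (.instr c s) (ih _)

/-- The invariant rule for counting loops with a time bound: each of the `N` rounds pays one test
besides the body, and the failing test at the end pays one more. -/
theorem exec_count {a c T N : ℕ} {p : Program} (I : ℕ → Config → Prop)
    (hI : ∀ k s, I k s → s.idx a = k ∧ s.idx c = N)
    (step : ∀ k < N, ∀ s, I k s → ∃ s' t, Exec p s s' t ∧ t ≤ T ∧ I (k + 1) s')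
    {s : Config} (h0 : I 0 s) :
    ∃ s' t, Exec (.while (.ilt a c) p) s s' t ∧ t ≤ N * (T + 1) + 1 ∧ I N s' := by
  have aux : ∀ m k s, k + m = N → I k s →
      ∃ s' t, Exec (.while (.ilt a c) p) s s' t ∧ t ≤ m * (T + 1) + 1 ∧ I N s' := by
    intro m
    induction m with
    | zero =>
      rintro k s rfl h
      refine ⟨s, 1, .while_false ?_, by simp, h⟩
      simp [Test.Holds, hI _ _ h]
    | succ m ih =>
      intro k s hk h
      obtain ⟨s', t, he, ht, h'⟩ := step k (by omega) s h
      obtain ⟨s'', t', he', ht', h''⟩ := ih (k + 1) s' (by omega) h'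
      refine ⟨s'', _, .while_true ?_ he he', ?_, h''⟩
      · simp only [Test.Holds, hI _ _ h]
        omega
      · rw [Nat.succ_mul]
        omega
  exact aux N 0 s (by simp) h0

theorem pair_inj {n i j k l : ℕ} (hj : j < n) (hl : l < n) (h : i * n + j = k * n + l) :
    i = k ∧ j = l := by
  have hik : i = k := by
    have h1 : (i * n + j) / n = i := by
      rw [Nat.mul_comm, Nat.mul_add_div (by omega), Nat.div_eq_of_lt hj, Nat.add_zero]
    have h2 : (k * n + l) / n = k := by
      rw [Nat.mul_comm, Nat.mul_add_div (by omega), Nat.div_eq_of_lt hl, Nat.add_zero]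
    rw [← h1, h, h2]
  subst hik
  exact ⟨rfl, by omega⟩

theorem pair_lt {n i j : ℕ} (hi : i < n) (hj : j < n) : i * n + j < n * n := by
  have : (i + 1) * n ≤ n * n := Nat.mul_le_mul_right _ hi
  rw [Nat.succ_mul] at this
  omega

/-! ### The passes of the conversion program -/

/-- The register contents that the passes of the conversion program share. -/
structure Constants (n : ℕ) (ε : ℝ) (s : Config) : Prop where
  dim : s.idx 0 = n
  one : s.idx 1 = 1
  size : s.idx 2 = n * n
  inv : s.reg 1 = 1 / (n : ℝ)
  bound : s.reg 2 = (ε ^ 2 / n) ^ 2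
  scale : s.reg 3 = n / (1 + ε ^ 2)
  unit : s.reg 5 = 1

open Classical in
/-- The factor by which the rows and columns with index `i` are multiplied. -/
noncomputable def flag (n : ℕ) (ε : ℝ) (M : ℕ → ℝ) (i : ℕ) : ℝ :=
  if (ε ^ 2 / n) ^ 2 < (M (i * n + i) - 1 / n) ^ 2 then 0 else 1

/-- The entries of the output off the diagonal. -/
noncomputable def scaled (n : ℕ) (ε : ℝ) (M : ℕ → ℝ) (i j : ℕ) : ℝ :=
  M (i * n + j) * (flag n ε M j * (flag n ε M i * (n / (1 + ε ^ 2))))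

/-- Compute the constants. -/
def setup : Program :=
  .seq (block [.iconst 1 1, .rconst 5 1, .rcast 4 0, .rdiv 1 5 4, .rmul 6 0 0, .rdiv 2 6 4,
      .rmul 2 2 2, .radd 6 5 6, .rdiv 3 4 6])
    -- Index registers cannot be multiplied, so `n * n` is accumulated by `n` additions.
    (.while (.ilt 3 0) (block [.iadd 2 2 0, .iadd 3 3 1]))

theorem exec_setup {n : ℕ} (ε : ℝ) (ρ : Matrix (Fin n) (Fin n) ℝ) :
    ∃ s t, Exec setup (input ε ρ) s t ∧ t ≤ 3 * n + 10 ∧ Constants n ε s ∧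
      s.mem = (input ε ρ).mem := by
  obtain ⟨s, t, he, ht, hs⟩ := exec_count (a := 3) (c := 0) (T := 2) (N := n)
    (p := block [.iadd 2 2 0, .iadd 3 3 1])
    (fun k s => s.idx 3 = k ∧ s.idx 0 = n ∧ s.idx 1 = 1 ∧ s.idx 2 = k * n ∧
      s.reg 1 = 1 / (n : ℝ) ∧ s.reg 2 = (ε ^ 2 / n) ^ 2 ∧ s.reg 3 = n / (1 + ε ^ 2) ∧
      s.reg 5 = 1 ∧ s.mem = (input ε ρ).mem)
    (fun k s h => ⟨h.1, h.2.1⟩)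
    (by
      rintro k - s ⟨h3, h0, h1, h2, hr1, hr2, hr3, hr5, hm⟩
      refine ⟨_, _, exec_block _ _, le_rfl, ?_⟩
      simp [Instr.apply, h3, h0, h1, h2, hr1, hr2, hr3, hr5, hm,
        Nat.succ_mul])
    (s := [Instr.iconst 1 1, .rconst 5 1, .rcast 4 0, .rdiv 1 5 4, .rmul 6 0 0, .rdiv 2 6 4,
      .rmul 2 2 2, .radd 6 5 6, .rdiv 3 4 6].foldl Instr.apply (input ε ρ))
    (by simp [Instr.apply, input, sq])
  obtain ⟨-, h0, h1, h2, hr1, hr2, hr3, hr5, hm⟩ := hs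
  refine ⟨s, _, .seq (exec_block _ _) he, ?_, ⟨h0, h1, h2, hr1, hr2, hr3, hr5⟩, hm⟩
  simp only [List.length_cons, List.length_nil]
  omega

/-- Write the flags behind the matrix. -/
def markRows : Program :=
  .seq (block [.iconst 3 0, .iconst 4 0, .iconst 5 0, .iadd 5 5 2])
    (.while (.ilt 3 0)
      (.seq (block [.load 6 4, .rsub 6 6 1, .rmul 6 6 6])
        (.seq (.ite (.rlt 2 6) (.instr (.rconst 7 0)) (.instr (.rconst 7 1)))
          (block [.store 5 7, .iadd 4 4 0, .iadd 4 4 1, .iadd 5 5 1, .iadd 3 3 1]))))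

theorem exec_ite_flag (n : ℕ) (ε : ℝ) (M : ℕ → ℝ) (k : ℕ) (s : Config)
    (h2 : s.reg 2 = (ε ^ 2 / n) ^ 2) (h6 : s.reg 6 = (M (k * n + k) - 1 / n) ^ 2) :
    Exec (.ite (.rlt 2 6) (.instr (.rconst 7 0)) (.instr (.rconst 7 1))) s
      { s with reg := Function.update s.reg 7 (flag n ε M k) } 2 := by
  by_cases h : (ε ^ 2 / n) ^ 2 < (M (k * n + k) - 1 / n) ^ 2
  · have := Exec.ite_true (b := .rlt 2 6) (q := .instr (.rconst 7 1)) (s := s)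
      (by simpa only [Test.Holds, h2, h6] using h) (.instr (.rconst 7 0) s)
    simpa only [flag, if_pos h, Instr.apply, Rat.cast_zero] using this
  · have := Exec.ite_false (b := .rlt 2 6) (p := .instr (.rconst 7 0)) (s := s)
      (by simpa only [Test.Holds, h2, h6] using h) (.instr (.rconst 7 1) s)
    simpa only [flag, if_neg h, Instr.apply, Rat.cast_one] using this

/-- The flags get their own cells, starting at `n * n`, because the later in-place scaling
overwrites the diagonal entries they are computed from. -/
theorem exec_markRows {n : ℕ} {ε : ℝ} {M : ℕ → ℝ} {s : Config} (hs : Constants n ε s)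
    (hM : s.mem = M) :
    ∃ s' t, Exec markRows s s' t ∧ t ≤ 11 * n + 5 ∧ Constants n ε s' ∧
      (∀ m < n * n, s'.mem m = M m) ∧ ∀ i < n, s'.mem (n * n + i) = flag n ε M i := by
  obtain ⟨s', t, he, ht, hs'⟩ := exec_count (a := 3) (c := 0) (T := 10) (N := n)
    (p := .seq (block [.load 6 4, .rsub 6 6 1, .rmul 6 6 6])
        (.seq (.ite (.rlt 2 6) (.instr (.rconst 7 0)) (.instr (.rconst 7 1)))
          (block [.store 5 7, .iadd 4 4 0, .iadd 4 4 1, .iadd 5 5 1, .iadd 3 3 1])))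
    (fun k s => s.idx 3 = k ∧ Constants n ε s ∧ s.idx 4 = k * n + k ∧ s.idx 5 = n * n + k ∧
      (∀ m < n * n, s.mem m = M m) ∧ ∀ i < k, s.mem (n * n + i) = flag n ε M i)
    (fun k s h => ⟨h.1, h.2.1.dim⟩)
    (by
      rintro k hk s ⟨h3, hc, h4, h5, hm, hf⟩
      refine ⟨_, _, .seq (exec_block _ _) (.seq (exec_ite_flag n ε M k _ ?_ ?_)
        (exec_block _ _)), le_rfl, ?_, ⟨?_, ?_, ?_, ?_, ?_, ?_, ?_⟩, ?_, ?_, ?_, ?_⟩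
      · simp [Instr.apply, hc.bound]
      · simp [Instr.apply, hc.inv, h4, hm _ (pair_lt hk hk), sq]
      · simp [Instr.apply, h3, hc.one]
      · simp [Instr.apply, hc.dim]
      · simp [Instr.apply, hc.one]
      · simp [Instr.apply, hc.size]
      · simp [Instr.apply, hc.inv]
      · simp [Instr.apply, hc.bound]
      · simp [Instr.apply, hc.scale]
      · simp [Instr.apply, hc.unit]
      · simp [Instr.apply, h4, hc.dim, hc.one, Nat.succ_mul]
        omega
      · simp [Instr.apply, h5, hc.one]
        omega
      · intro m hm'
        have : m ≠ n * n + k := by omega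
        simp [Instr.apply, h5, this, hm m hm']
      · intro i hi
        rcases Nat.lt_succ_iff_lt_or_eq.mp hi with h | rfl
        · have : i ≠ k := by omega
          simp [Instr.apply, h5, this, hf i h]
        · simp [Instr.apply, h5])
    (s := [Instr.iconst 3 0, .iconst 4 0, .iconst 5 0, .iadd 5 5 2].foldl Instr.apply s)
    (by
      refine ⟨?_, ⟨?_, ?_, ?_, ?_, ?_, ?_, ?_⟩, ?_, ?_, ?_, ?_⟩ <;>
        simp [Instr.apply, hs.dim, hs.one, hs.size, hs.inv, hs.bound,
          hs.scale, hs.unit, hM])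
  obtain ⟨-, hc, -, -, hm, hf⟩ := hs'
  refine ⟨s', _, .seq (exec_block _ _) he, ?_, hc, hm, hf⟩
  simp only [List.length_cons, List.length_nil]
  omega

/-- Scale one row. -/
def scaleRow : Program :=
  .seq (block [.load 6 5, .rmul 6 6 3, .iconst 6 0, .iconst 7 0, .iadd 7 7 2])
    (.seq (.while (.ilt 6 0)
        (block [.load 7 7, .rmul 7 7 6, .load 8 4, .rmul 8 8 7, .store 4 8,
          .iadd 4 4 1, .iadd 7 7 1, .iadd 6 6 1]))
      (block [.iadd 5 5 1, .iadd 3 3 1]))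

/-- The state after `m` entries have been scaled. -/
structure ScaledUpTo (n : ℕ) (ε : ℝ) (M : ℕ → ℝ) (m : ℕ) (s : Config) : Prop where
  const : Constants n ε s
  pos : s.idx 4 = m
  done : ∀ i < n, ∀ j < n, i * n + j < m → s.mem (i * n + j) = scaled n ε M i j
  todo : ∀ k < n * n, m ≤ k → s.mem k = M k
  flags : ∀ i < n, s.mem (n * n + i) = flag n ε M i

theorem exec_scaleRow {n : ℕ} {ε : ℝ} {M : ℕ → ℝ} {i : ℕ} (hi : i < n) {s : Config}
    (hs : ScaledUpTo n ε M (i * n) s) (h3 : s.idx 3 = i) (h5 : s.idx 5 = n * n + i) :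
    ∃ s' t, Exec scaleRow s s' t ∧ t ≤ 9 * n + 8 ∧ ScaledUpTo n ε M ((i + 1) * n) s' ∧
      s'.idx 3 = i + 1 ∧ s'.idx 5 = n * n + (i + 1) := by
  obtain ⟨hc, h4, hd, htd, hf⟩ := hs
  obtain ⟨s', t, he, ht, hs'⟩ := exec_count (a := 6) (c := 0) (T := 8) (N := n)
    (p := block [.load 7 7, .rmul 7 7 6, .load 8 4, .rmul 8 8 7, .store 4 8,
          .iadd 4 4 1, .iadd 7 7 1, .iadd 6 6 1])
    (fun k s => s.idx 6 = k ∧ ScaledUpTo n ε M (i * n + k) s ∧ s.idx 3 = i ∧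
      s.idx 5 = n * n + i ∧ s.idx 7 = n * n + k ∧
      s.reg 6 = flag n ε M i * (n / (1 + ε ^ 2)))
    (fun k s h => ⟨h.1, h.2.1.const.dim⟩)
    (by
      rintro k hk s ⟨h6, ⟨hc, h4, hd, htd, hf⟩, h3, h5, h7, hr⟩
      have hlt := pair_lt hi hk
      refine ⟨_, _, exec_block _ _, le_rfl, ?_,
        ⟨⟨?_, ?_, ?_, ?_, ?_, ?_, ?_⟩, ?_, ?_, ?_, ?_⟩, ?_, ?_, ?_, ?_⟩
      · simp [Instr.apply, h6, hc.one]
      · simp [Instr.apply, hc.dim]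
      · simp [Instr.apply, hc.one]
      · simp [Instr.apply, hc.size]
      · simp [Instr.apply, hc.inv]
      · simp [Instr.apply, hc.bound]
      · simp [Instr.apply, hc.scale]
      · simp [Instr.apply, hc.unit]
      · simp [Instr.apply, h4, hc.one, Nat.add_assoc]
      · intro i' hi' j hj hlt'
        by_cases h : i' * n + j = i * n + k
        · obtain ⟨rfl, rfl⟩ := pair_inj hj hk h
          simp [Instr.apply, h4, h7, hf _ hk, hr, htd _ hlt le_rfl,
            scaled]
        · have := hd i' hi' j hj (by omega)
          simp [Instr.apply, h4, h, this]
      · intro m hm hle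
        have : m ≠ i * n + k := by omega
        simp [Instr.apply, h4, this, htd m hm (by omega)]
      · intro i' hi'
        -- The cell being written lies inside the matrix, so no flag is overwritten.
        have : n * n + i' ≠ i * n + k := by omega
        simp [Instr.apply, h4, this, hf i' hi']
      · simp [Instr.apply, h3]
      · simp [Instr.apply, h5]
      · simp [Instr.apply, h7, hc.one, Nat.add_assoc]
      · simp [Instr.apply, hr])
    (s := [Instr.load 6 5, .rmul 6 6 3, .iconst 6 0, .iconst 7 0, .iadd 7 7 2].foldl
      Instr.apply s)
    (by
      refine ⟨?_, ⟨⟨?_, ?_, ?_, ?_, ?_, ?_, ?_⟩, ?_, ?_, ?_, ?_⟩, ?_, ?_, ?_, ?_⟩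
      rotate_left 9
      · simpa [Instr.apply] using hd
      · simpa [Instr.apply] using htd
      all_goals simp [Instr.apply, hc.dim, hc.one, hc.size, hc.inv,
        hc.bound, hc.scale, hc.unit, h3, h4, h5, hf _ hi]
      simpa using hf)
  obtain ⟨-, ⟨hc, h4, hd, htd, hf⟩, h3, h5, -, -⟩ := hs'
  refine ⟨_, _, .seq (exec_block _ _) (.seq he (exec_block _ _)), ?_,
    ⟨⟨?_, ?_, ?_, ?_, ?_, ?_, ?_⟩, ?_, ?_, ?_, ?_⟩, ?_, ?_⟩
  · simp only [List.length_cons, List.length_nil]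
    omega
  rotate_left 8
  · simpa [Instr.apply, Nat.succ_mul] using hd
  · simpa [Instr.apply, Nat.succ_mul] using htd
  · simpa [Instr.apply] using hf
  all_goals simp [Instr.apply, hc.dim, hc.one, hc.size, hc.inv,
        hc.bound, hc.scale, hc.unit, h3, h4, h5, Nat.succ_mul, Nat.add_assoc]

/-- Scale all rows. -/
def scaleRows : Program :=
  .seq (block [.iconst 3 0, .iconst 4 0, .iconst 5 0, .iadd 5 5 2]) (.while (.ilt 3 0) scaleRow)

theorem exec_scaleRows {n : ℕ} {ε : ℝ} {M : ℕ → ℝ} {s : Config} (hs : Constants n ε s)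
    (hM : ∀ m < n * n, s.mem m = M m) (hf : ∀ i < n, s.mem (n * n + i) = flag n ε M i) :
    ∃ s' t, Exec scaleRows s s' t ∧ t ≤ n * (9 * n + 9) + 5 ∧ Constants n ε s' ∧
      ∀ i < n, ∀ j < n, s'.mem (i * n + j) = scaled n ε M i j := by
  obtain ⟨s', t, he, ht, hs'⟩ := exec_count (a := 3) (c := 0) (T := 9 * n + 8) (N := n)
    (p := scaleRow)
    (fun k s => s.idx 3 = k ∧ ScaledUpTo n ε M (k * n) s ∧ s.idx 5 = n * n + k)
    (fun k s h => ⟨h.1, h.2.1.const.dim⟩)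
    (by
      rintro k hk s ⟨h3, hs, h5⟩
      obtain ⟨s', t, he, ht, h, h3', h5'⟩ := exec_scaleRow hk hs h3 h5
      exact ⟨s', t, he, ht, h3', h, h5'⟩)
    (s := [Instr.iconst 3 0, .iconst 4 0, .iconst 5 0, .iadd 5 5 2].foldl Instr.apply s)
    (by
      refine ⟨?_, ⟨⟨?_, ?_, ?_, ?_, ?_, ?_, ?_⟩, ?_, ?_, ?_, ?_⟩, ?_⟩
      rotate_left 10
      · simpa [Instr.apply] using hM
      · simpa [Instr.apply] using hf
      all_goals simp [Instr.apply, hs.dim, hs.one, hs.size, hs.inv,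
        hs.bound, hs.scale, hs.unit])
  refine ⟨s', _, .seq (exec_block _ _) he, ?_, hs'.2.1.const, fun i hi j hj =>
    hs'.2.1.done i hi j hj (pair_lt hi hj)⟩
  simp only [List.length_cons, List.length_nil]
  change t ≤ n * (9 * n + 9) + 1 at ht
  omega

/-- Put `1` on the diagonal. -/
def fillDiag : Program :=
  .seq (block [.iconst 3 0, .iconst 4 0])
    (.while (.ilt 3 0) (block [.store 4 5, .iadd 4 4 0, .iadd 4 4 1, .iadd 3 3 1]))

/-- The diagonal left behind by the scaling is irrelevant: every such entry is overwritten here. -/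
theorem exec_fillDiag {n : ℕ} {ε : ℝ} {D : ℕ → ℕ → ℝ} {s : Config} (hs : Constants n ε s)
    (hD : ∀ i < n, ∀ j < n, s.mem (i * n + j) = D i j) :
    ∃ s' t, Exec fillDiag s s' t ∧ t ≤ 5 * n + 3 ∧
      ∀ i < n, ∀ j < n, s'.mem (i * n + j) = if i = j then 1 else D i j := by
  obtain ⟨s', t, he, ht, hs'⟩ := exec_count (a := 3) (c := 0) (T := 4) (N := n)
    (p := block [.store 4 5, .iadd 4 4 0, .iadd 4 4 1, .iadd 3 3 1])
    (fun k s => s.idx 3 = k ∧ s.idx 0 = n ∧ s.idx 1 = 1 ∧ s.reg 5 = 1 ∧ s.idx 4 = k * n + k ∧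
      ∀ i < n, ∀ j < n, s.mem (i * n + j) = if i = j ∧ i < k then 1 else D i j)
    (fun k s h => ⟨h.1, h.2.1⟩)
    (by
      rintro k hk s ⟨h3, h0, h1, h5, h4, hm⟩
      refine ⟨_, _, exec_block _ _, le_rfl, ?_, ?_, ?_, ?_, ?_, ?_⟩
      rotate_left 5
      · intro i hi j hj
        by_cases h : i * n + j = k * n + k
        · obtain ⟨rfl, rfl⟩ := pair_inj hj hk h
          simp [Instr.apply, h4, h5]
        · have h' : ¬ (i = j ∧ i = k) := by
            rintro ⟨rfl, rfl⟩
            exact h rfl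
          have h'' : (i = j ∧ i ≤ k) ↔ (i = j ∧ i < k) := by omega
          simp [Instr.apply, h4, h, hm i hi j hj, h'']
      all_goals simp [Instr.apply, h0, h1, h3, h4, h5, Nat.succ_mul]
      omega)
    (s := [Instr.iconst 3 0, .iconst 4 0].foldl Instr.apply s)
    (by
      refine ⟨?_, ?_, ?_, ?_, ?_, ?_⟩
      rotate_left 5
      · simpa [Instr.apply] using hD
      all_goals simp [Instr.apply, hs.dim, hs.one, hs.unit])
  refine ⟨s', _, .seq (exec_block _ _) he, ?_, fun i hi j hj => ?_⟩
  · simp only [List.length_cons, List.length_nil]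
    omega
  · rw [hs'.2.2.2.2.2 i hi j hj]
    simp [hi]

/-- The conversion of approximately feasible into feasible points. -/
def conversion : Program :=
  .seq setup (.seq markRows (.seq scaleRows fillDiag))

/-! ### Correctness and running time of the program -/

theorem input_mem {n : ℕ} (ε : ℝ) (ρ : Matrix (Fin n) (Fin n) ℝ) (i j : Fin n) :
    (input ε ρ).mem (i * n + j) = ρ i j := by
  have h : finProdFinEquiv.symm ⟨i * n + j, pair_lt i.2 j.2⟩ = (i, j) := by
    rw [Equiv.symm_apply_eq]
    ext
    simp [Nat.add_comm, Nat.mul_comm]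
  simp only [input, pair_lt i.2 j.2, dite_true, h]

/-- Without an absolute value among the instructions, the program compares squares; this is
equivalent since `ε ^ 2 / n` is nonnegative. -/
theorem flag_input {n : ℕ} (ε : ℝ) (ρ : Matrix (Fin n) (Fin n) ℝ) (i : Fin n)
    [Decidable (MaxQP.Deviates ε ρ i)] :
    flag n ε (input ε ρ).mem i = if MaxQP.Deviates ε ρ i then 0 else 1 := by
  have h : (ε ^ 2 / n) ^ 2 < ((input ε ρ).mem (i * n + i) - 1 / n) ^ 2 ↔
      MaxQP.Deviates ε ρ i := by
    rw [input_mem, sq_lt_sq, abs_of_nonneg (by positivity), MaxQP.Deviates]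
  simp only [flag, h]

theorem smul_convert_apply {n : ℕ} (hn : 0 < n) (ε : ℝ) (ρ : Matrix (Fin n) (Fin n) ℝ)
    (i j : Fin n) :
    ((n : ℝ) • MaxQP.convert ε ρ) i j =
      if (i : ℕ) = j then 1 else scaled n ε (input ε ρ).mem i j := by
  classical
  have h0 : (n : ℝ) ≠ 0 := by positivity
  by_cases hij : i = j
  · subst hij
    simp [MaxQP.convert_diag, h0]
  · have hij' : (i : ℕ) ≠ j := fun h => hij (Fin.ext h)
    rw [if_neg hij', scaled, input_mem, flag_input, flag_input]
    simp only [MaxQP.convert, MaxQP.resetDiag, MaxQP.clearDeviating, Matrix.smul_apply,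
      Matrix.add_apply, Matrix.of_apply, Matrix.one_apply, hij, if_false, smul_eq_mul]
    by_cases hi : MaxQP.Deviates ε ρ i <;> by_cases hj : MaxQP.Deviates ε ρ j <;>
      simp [hi, hj]
    ring

theorem computesWithin_conversion {n : ℕ} (hn : 0 < n) (ε : ℝ) (ρ : Matrix (Fin n) (Fin n) ℝ) :
    ComputesWithin conversion (60 * n ^ 2) ε ρ ((n : ℝ) • MaxQP.convert ε ρ) := by
  obtain ⟨s₁, t₁, e₁, l₁, c₁, m₁⟩ := exec_setup ε ρ
  obtain ⟨s₂, t₂, e₂, l₂, c₂, m₂, f₂⟩ := exec_markRows c₁ m₁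
  obtain ⟨s₃, t₃, e₃, l₃, c₃, m₃⟩ := exec_scaleRows c₂ m₂ f₂
  obtain ⟨s₄, t₄, e₄, l₄, m₄⟩ := exec_fillDiag c₃ m₃
  -- The four passes total at most `9n² + 28n + 23` steps, which is at most `60n²` as `n ≥ 1`.
  refine ⟨s₄, _, .seq e₁ (.seq e₂ (.seq e₃ e₄)), by nlinarith, fun i j => ?_⟩
  rw [m₄ i i.2 j j.2, smul_convert_apply hn]

end RealRAM

theorem mainTheorem5 :
    ∃ C : ℝ, ∃ K : ℕ, ∃ p : RealRAM.Program,
      ∀ (n : ℕ), 0 < n → ∀ (A : Matrix (Fin n) (Fin n) ℝ), A.IsSymm → ∀ (ε : ℝ), 0 < ε →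
        |MaxQP.relaxedValue (ε ^ 4) A * (n * MaxQP.opNorm A) - MaxQP.value A|
            ≤ C * (ε * n * MaxQP.opNorm A) ∧
        ∀ ρ : Matrix (Fin n) (Fin n) ℝ, MaxQP.IsApproxSolution (ε ^ 4) A ρ →
          |MaxQP.renormObjective A ρ * (n * MaxQP.opNorm A) - MaxQP.value A|
            ≤ C * (ε * n * MaxQP.opNorm A) ∧
          (n : ℝ) • MaxQP.convert ε ρ ∈ MaxQP.Feasible n ∧
          |(A * ((n : ℝ) • MaxQP.convert ε ρ)).trace - MaxQP.value A|
            ≤ C * (ε * n * MaxQP.opNorm A) ∧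
          RealRAM.ComputesWithin p (K * n ^ 2) ε ρ ((n : ℝ) • MaxQP.convert ε ρ) := by
  -- The constant `14 = 7 + 7` is needed for the rounded point only: `7 * ε` from `ρ` to the optimum
  -- and `7 * ε` from the rounding.
  refine ⟨14, 60, RealRAM.conversion, fun n hn A _ ε hε => ⟨?_, fun ρ hρ => ⟨?_, ?_, ?_, ?_⟩⟩⟩
  · refine MaxQP.abs_mul_sub_value_le hn ?_
    linarith [MaxQP.abs_relaxedValue_sub_le A hn hε]
  · refine MaxQP.abs_mul_sub_value_le hn ?_
    linarith [MaxQP.abs_renormObjective_sub_le hn hε hρ]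
  · exact MaxQP.smul_mem_feasible hn (MaxQP.posSemidef_convert ε hρ.1.1.1)
      (MaxQP.convert_diag ε ρ)
  · have h : (A * ((n : ℝ) • MaxQP.convert ε ρ)).trace =
        MaxQP.renormObjective A (MaxQP.convert ε ρ) * (n * MaxQP.opNorm A) := by
      rw [Matrix.mul_smul, Matrix.trace_smul, smul_eq_mul, ← MaxQP.renormObjective_mul_opNorm]
      ring
    rw [h]
    refine MaxQP.abs_mul_sub_value_le hn ?_
    have h1 := abs_le.mp (MaxQP.abs_renormObjective_sub_convert_le A hn hε hρ.1)
    have h2 := abs_le.mp (MaxQP.abs_renormObjective_sub_le hn hε hρ)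
    rw [abs_le]
    constructor <;> linarith [h1.1, h1.2, h2.1, h2.2]
  · exact RealRAM.computesWithin_conversion hn ε ρ
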